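/- Let $\mathcal F^2$ be the Fock space, i.e. the Hilbert space of entire functions $f:\mathbb C\to\mathbb C$ with $\frac1\pi\int_{\mathbb C}|f(z)|^2e^{-|z|^2}\,dV(z)<\infty$ ($dV$ is Lebesgue measure), with inner product $\langle f,g\rangle=\frac1\pi\int_{\mathbb C}f(z)\overline{g(z)}e^{-|z|^2}\,dV(z)$. For entire functions $\psi,\varphi$, the maximal weighted composition operator $W_{\psi,\varphi,\max}$ on $\mathcal F^2$ has domain $\{f\in\mathcal F^2:\psi\cdot (f\circ\varphi)\in\mathcal F^2\}$ and acts by $W_{\psi,\varphi,\max}f=\psi\cdot (f\circ\varphi)$. An operator $T$ on a Hilbert space is called cohyponormal if it is closed and densely defined, $\operatorname{dom}(T^*)\subseteq\operatorname{dom}(T)$, and $\|T^*x\|\ge\|Tx\|$ for all $x\in\operatorname{dom}(T^*)$. Theorem. Let $\varphi,\psi$ be entire functions with $\psi\not\equiv0$. The following assertions are equivalent. (1) The operator $W_{\psi,\varphi,\max}$ is cohyponormal. (2) One of the following cases occurs: (a) there are complex constants $A,B,C,D$ with $A\ne1$ such that $\varphi(z)=Az+B$ and $\psi(z)=Ce^{Dz}$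 for all $z\in\mathbb C$, and $D=\overline B(1-A)(1-\overline A)^{-1}$; (b) there are complex constants $B,C,D$ such that $\varphi(z)=z+B$ and $\psi(z)=Ce^{Dz}$ for all $z\in\mathbb C$, and $|B|\ge|D|$. -/

import Mathlib

open MeasureTheory Filter Topology
open scoped ComplexConjugate LinearPMap

noncomputable section

/-! ## The Fock space -/

/-- Integrability of `‖f‖² e^{-|z|²}`, i.e. square integrability with respect to the (unnormalized)
Gaussian measure. -/
def GaussSqIntegrable (f : ℂ → ℂ) : Prop :=
  Integrable (fun z : ℂ => ‖f z‖ ^ 2 * Real.exp (-‖z‖ ^ 2)) volume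

theorem GaussSqIntegrable.mul_conj {f g : ℂ → ℂ} (hf : Differentiable ℂ f)
    (hg : Differentiable ℂ g) (hf2 : GaussSqIntegrable f) (hg2 : GaussSqIntegrable g) :
    Integrable (fun z : ℂ => f z * conj (g z) * (Real.exp (-‖z‖ ^ 2) : ℂ)) volume := by
  have hfc := hf.continuous
  have hgc := hg.continuous
  refine (Integrable.add hf2 hg2).mono' (Continuous.aestronglyMeasurable (by fun_prop)) ?_
  refine Eventually.of_forall fun z => ?_
  have he := Real.exp_pos (-‖z‖ ^ 2)
  simp only [norm_mul, Pi.add_apply, RCLike.norm_conj, Complex.norm_real, Real.norm_eq_abs,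
    abs_of_pos he]
  have h : ‖f z‖ * ‖g z‖ ≤ ‖f z‖ ^ 2 + ‖g z‖ ^ 2 := by
    nlinarith [sq_nonneg (‖f z‖ - ‖g z‖), sq_nonneg ‖f z‖, sq_nonneg ‖g z‖]
  nlinarith

theorem GaussSqIntegrable.add {f g : ℂ → ℂ} (hf : Differentiable ℂ f)
    (hg : Differentiable ℂ g) (hf2 : GaussSqIntegrable f) (hg2 : GaussSqIntegrable g) :
    GaussSqIntegrable (f + g) := by
  have hfc := hf.continuous
  have hgc := hg.continuous
  have hi := ((Integrable.add hf2 hg2).const_mul 2)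
  refine hi.mono' (Continuous.aestronglyMeasurable (by simp only [Pi.add_apply]; fun_prop)) ?_
  refine Eventually.of_forall fun z => ?_
  have he := Real.exp_pos (-‖z‖ ^ 2)
  simp only [Pi.add_apply]
  rw [Real.norm_of_nonneg (by positivity)]
  have h0 := norm_add_le (f z) (g z)
  have h : ‖f z + g z‖ ^ 2 ≤ 2 * (‖f z‖ ^ 2 + ‖g z‖ ^ 2) := by
    nlinarith [sq_nonneg (‖f z‖ - ‖g z‖), norm_nonneg (f z + g z)]
  nlinarith

/-- The entire functions that are square integrable with respect to the Gaussian measure. -/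
def fockSubmodule : Submodule ℂ (ℂ → ℂ) where
  carrier := {f | Differentiable ℂ f ∧ GaussSqIntegrable f}
  zero_mem' := ⟨differentiable_const 0, by simp [GaussSqIntegrable]⟩
  add_mem' := fun ha hb => ⟨ha.1.add hb.1, GaussSqIntegrable.add ha.1 hb.1 ha.2 hb.2⟩
  smul_mem' := fun c f hf => ⟨hf.1.const_smul c, by
    refine (Integrable.const_mul hf.2 (‖c‖ ^ 2)).congr (Eventually.of_forall fun z => ?_)
    simp [mul_pow, mul_assoc]⟩

/-- The Fock space `F²`. A separate type, so that it carries the Hilbert space topology below and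
not the topology of pointwise convergence. -/
def FockSpace : Type := fockSubmodule

namespace FockSpace

instance : AddCommGroup FockSpace := inferInstanceAs (AddCommGroup fockSubmodule)
instance : Module ℂ FockSpace := inferInstanceAs (Module ℂ fockSubmodule)

/-- The entire function underlying an element of the Fock space. -/
def toFun (f : FockSpace) : ℂ → ℂ := Subtype.val (p := fun g => g ∈ fockSubmodule) f

instance : CoeFun FockSpace (fun _ => ℂ → ℂ) := ⟨toFun⟩

/-- An entire, Gauss-square-integrable function as an element of the Fock space. -/
def mk (f : ℂ → ℂ) (hf : f ∈ fockSubmodule) : FockSpace :=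
  (⟨f, hf⟩ : fockSubmodule)

@[simp] theorem mk_apply (f : ℂ → ℂ) (hf : f ∈ fockSubmodule) (z : ℂ) : mk f hf z = f z := rfl

@[ext] theorem ext {f g : FockSpace} (h : ∀ z, f z = g z) : f = g := Subtype.ext (funext h)

@[simp] theorem zero_apply (z : ℂ) : (0 : FockSpace) z = 0 := rfl
@[simp] theorem add_apply (f g : FockSpace) (z : ℂ) : (f + g) z = f z + g z := rfl
@[simp] theorem sub_apply (f g : FockSpace) (z : ℂ) : (f - g) z = f z - g z := rfl
@[simp] theorem smul_apply (c : ℂ) (f : FockSpace) (z : ℂ) : (c • f) z = c * f z := rfl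

theorem mem (f : FockSpace) : (f : ℂ → ℂ) ∈ fockSubmodule :=
  Subtype.property (p := fun g => g ∈ fockSubmodule) f

theorem differentiable (f : FockSpace) : Differentiable ℂ f := f.mem.1

theorem gaussSqIntegrable (f : FockSpace) : GaussSqIntegrable f := f.mem.2

/-- The pairing `(1/π) ∫ f(z) conj(g(z)) e^{-|z|²} dV(z)`, linear in `f`. -/
def pairing (f g : FockSpace) : ℂ :=
  (1 / (Real.pi : ℂ)) * ∫ z : ℂ, f z * conj (g z) * (Real.exp (-‖z‖ ^ 2) : ℂ)

theorem integrable_pairing (f g : FockSpace) :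
    Integrable (fun z : ℂ => f z * conj (g z) * (Real.exp (-‖z‖ ^ 2) : ℂ)) volume :=
  GaussSqIntegrable.mul_conj f.differentiable g.differentiable f.gaussSqIntegrable
    g.gaussSqIntegrable

theorem pairing_self (f : FockSpace) : pairing f f =
    ((1 / Real.pi * ∫ z : ℂ, ‖f z‖ ^ 2 * Real.exp (-‖z‖ ^ 2) : ℝ) : ℂ) := by
  rw [pairing, Complex.ofReal_mul, ← integral_complex_ofReal]
  simp [Complex.mul_conj, Complex.normSq_eq_norm_sq]

/-- The Fock space inner product. Mathlib's `inner ℂ g f` is linear in the second variable, so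
`inner ℂ g f` is the usual `⟨f, g⟩`. -/
@[reducible] def core : InnerProductSpace.Core ℂ FockSpace where
  inner g f := pairing f g
  conj_inner_symm f g := by
    simp only [pairing, map_mul, ← integral_conj, map_div₀, map_one, Complex.conj_ofReal,
      Complex.conj_conj]
    congr 2
    funext z
    ring
  re_inner_nonneg f := by
    rw [pairing_self, RCLike.re_to_complex, Complex.ofReal_re]
    have := Real.pi_pos
    exact mul_nonneg (by positivity) (integral_nonneg fun z => by positivity)
  add_left f g h := by
    simp only [pairing, ← mul_add]
    rw [← integral_add (integrable_pairing _ _) (integrable_pairing _ _)]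
    congr 2
    funext z
    simp only [add_apply, map_add]
    ring
  smul_left f g c := by
    simp only [pairing]
    rw [mul_left_comm, ← integral_const_mul (conj c)]
    congr 2
    funext z
    simp only [smul_apply, map_mul]
    ring
  definite f hf := by
    rw [pairing_self, Complex.ofReal_eq_zero] at hf
    have hpi := Real.pi_pos
    have h0 : ∫ z : ℂ, ‖f z‖ ^ 2 * Real.exp (-‖z‖ ^ 2) = 0 := by
      rcases mul_eq_zero.1 hf with h | h
      · exact absurd h (by positivity)
      · exact h
    rw [integral_eq_zero_iff_of_nonneg (fun z => by positivity) f.gaussSqIntegrable] at h0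
    have hc := f.differentiable.continuous
    have := (Continuous.ae_eq_iff_eq volume (by fun_prop) continuous_const).1 h0
    ext z
    have hz : ‖f z‖ ^ 2 * Real.exp (-‖z‖ ^ 2) = 0 := congrFun this z
    simpa using hz

instance : NormedAddCommGroup FockSpace :=
  InnerProductSpace.Core.toNormedAddCommGroup (𝕜 := ℂ) (cd := core)

instance : InnerProductSpace ℂ FockSpace := InnerProductSpace.ofCore core.toCore

theorem inner_def (f g : FockSpace) : inner ℂ g f =
    (1 / (Real.pi : ℂ)) * ∫ z : ℂ, f z * conj (g z) * (Real.exp (-‖z‖ ^ 2) : ℂ) := rfl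

theorem norm_sq_eq (f : FockSpace) :
    ‖f‖ ^ 2 = 1 / Real.pi * ∫ z : ℂ, ‖f z‖ ^ 2 * Real.exp (-‖z‖ ^ 2) := by
  have h := inner_self_eq_norm_sq_to_K (𝕜 := ℂ) f
  have h2 : inner ℂ f f = pairing f f := rfl
  rw [h2, pairing_self] at h
  exact (Complex.ofReal_injective (by rw [h]; push_cast; rfl))

/-! ### Completeness -/

theorem lintegral_eq (f : FockSpace) :
    ∫⁻ z : ℂ, ‖f z‖ₑ ^ 2 * ENNReal.ofReal (Real.exp (-‖z‖ ^ 2)) =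
      ENNReal.ofReal (Real.pi * ‖f‖ ^ 2) := by
  have hpi := Real.pi_pos
  rw [norm_sq_eq, ← mul_assoc, mul_one_div_cancel hpi.ne', one_mul,
    ofReal_integral_eq_lintegral_ofReal f.gaussSqIntegrable
      (Eventually.of_forall fun z => by positivity)]
  congr 1
  ext z
  rw [ENNReal.ofReal_mul (by positivity), ENNReal.ofReal_pow (norm_nonneg _), ofReal_norm]

/-- Mean value inequality for `|f|²` on a circle. -/
theorem sq_norm_le_circle {f : ℂ → ℂ} (hf : Differentiable ℂ f) (w : ℂ) (r : ℝ) :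
    2 * ENNReal.ofReal Real.pi * ‖f w‖ₑ ^ 2 ≤
      ∫⁻ θ in Set.Ioo (-Real.pi) Real.pi, ‖f (circleMap w r θ)‖ₑ ^ 2 := by
  have hpi := Real.pi_pos
  have hmv := DiffContOnCl.circleAverage (f := fun z => f z ^ 2) (c := w) (R := r)
    (hf.pow 2).diffContOnCl
  rw [Real.circleAverage] at hmv
  have hper : Function.Periodic (fun θ => f (circleMap w r θ) ^ 2) (2 * Real.pi) := fun θ => by
    simp only [periodic_circleMap w r θ]
  have hshift := hper.intervalIntegral_add_eq 0 (-Real.pi)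
  rw [zero_add, show -Real.pi + 2 * Real.pi = Real.pi by ring] at hshift
  rw [hshift] at hmv
  have h1 : (2 * Real.pi) * ‖f w‖ ^ 2 = ‖∫ θ in (-Real.pi)..Real.pi, f (circleMap w r θ) ^ 2‖ := by
    rw [← norm_pow, ← hmv, norm_smul, Real.norm_of_nonneg (by positivity)]
    field_simp
  rw [intervalIntegral.integral_of_le (by linarith), integral_Ioc_eq_integral_Ioo] at h1
  calc 2 * ENNReal.ofReal Real.pi * ‖f w‖ₑ ^ 2
      = ENNReal.ofReal ((2 * Real.pi) * ‖f w‖ ^ 2) := by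
        rw [ENNReal.ofReal_mul (by positivity), ENNReal.ofReal_mul (by positivity),
          ENNReal.ofReal_pow (norm_nonneg _), ofReal_norm, ENNReal.ofReal_ofNat]
    _ = ‖∫ θ in Set.Ioo (-Real.pi) Real.pi, f (circleMap w r θ) ^ 2‖ₑ := by
        rw [h1, ofReal_norm]
    _ ≤ ∫⁻ θ in Set.Ioo (-Real.pi) Real.pi, ‖f (circleMap w r θ) ^ 2‖ₑ :=
        enorm_integral_le_lintegral_enorm _
    _ = _ := by simp only [enorm_pow]

/-- Mean value inequality for `|f|²` on a disc of radius one. -/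
theorem sq_norm_le_ball {f : ℂ → ℂ} (hf : Differentiable ℂ f) (w : ℂ) :
    ENNReal.ofReal Real.pi * ‖f w‖ₑ ^ 2 ≤ ∫⁻ z in Metric.closedBall w 1, ‖f z‖ₑ ^ 2 := by
  have hfc := hf.continuous
  have hpi := Real.pi_pos
  set F : ℂ → ENNReal := fun z => (Metric.closedBall w 1).indicator (fun z => ‖f z‖ₑ ^ 2) z with hF
  have hFm : Measurable F :=
    Measurable.indicator (by fun_prop) Metric.isClosed_closedBall.measurableSet
  have hpol : ∀ p : ℝ × ℝ, w + Complex.polarCoord.symm p = circleMap w p.1 p.2 := fun p => by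
    rw [Complex.polarCoord_symm_apply, circleMap, Complex.exp_mul_I]
    simp
  have h1 : ∫⁻ z in Metric.closedBall w 1, ‖f z‖ₑ ^ 2 =
      ∫⁻ r in Set.Ioi (0 : ℝ), ∫⁻ θ in Set.Ioo (-Real.pi) Real.pi,
        ENNReal.ofReal r * F (circleMap w r θ) := by
    rw [← lintegral_indicator Metric.isClosed_closedBall.measurableSet,
      ← lintegral_add_left_eq_self _ w, ← Complex.lintegral_comp_polarCoord_symm]
    simp only [hpol, smul_eq_mul]
    rw [polarCoord_target, Measure.volume_eq_prod, ← Measure.prod_restrict, lintegral_prod]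
    refine Measurable.aemeasurable (Measurable.mul (by fun_prop) (hFm.comp ?_))
    refine Continuous.measurable ?_
    simp only [circleMap]
    fun_prop
  have h2 : ∀ r ∈ Set.Ioo (0 : ℝ) 1, ENNReal.ofReal r * (2 * ENNReal.ofReal Real.pi * ‖f w‖ₑ ^ 2) ≤
      ∫⁻ θ in Set.Ioo (-Real.pi) Real.pi, ENNReal.ofReal r * F (circleMap w r θ) := by
    intro r hr
    rw [lintegral_const_mul' _ _ ENNReal.ofReal_ne_top]
    gcongr
    refine (sq_norm_le_circle hf w r).trans (le_of_eq ?_)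
    congr 1
    funext θ
    have : circleMap w r θ ∈ Metric.closedBall w 1 :=
      Metric.closedBall_subset_closedBall hr.2.le (circleMap_mem_closedBall w hr.1.le θ)
    simp [hF, this]
  have h3 : ∫⁻ r in Set.Ioo (0 : ℝ) 1, ENNReal.ofReal r = ENNReal.ofReal (1 / 2) := by
    rw [← ofReal_integral_eq_lintegral_ofReal]
    · rw [← integral_Ioc_eq_integral_Ioo, ← intervalIntegral.integral_of_le zero_le_one]
      simp
    · exact (continuous_id.integrableOn_Icc (a := (0 : ℝ)) (b := 1)).mono_set Set.Ioo_subset_Icc_self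
    · exact (ae_restrict_mem measurableSet_Ioo).mono fun r hr => hr.1.le
  calc ENNReal.ofReal Real.pi * ‖f w‖ₑ ^ 2
      = ENNReal.ofReal (1 / 2) * (2 * ENNReal.ofReal Real.pi * ‖f w‖ₑ ^ 2) := by
        rw [mul_assoc, ← mul_assoc (ENNReal.ofReal (1 / 2)), ← ENNReal.ofReal_ofNat 2,
          ← ENNReal.ofReal_mul (by norm_num)]
        norm_num
    _ = ∫⁻ r in Set.Ioo (0 : ℝ) 1,
          ENNReal.ofReal r * (2 * ENNReal.ofReal Real.pi * ‖f w‖ₑ ^ 2) := by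
        rw [lintegral_mul_const _ (by fun_prop), h3]
    _ ≤ ∫⁻ r in Set.Ioo (0 : ℝ) 1, ∫⁻ θ in Set.Ioo (-Real.pi) Real.pi,
          ENNReal.ofReal r * F (circleMap w r θ) :=
        setLIntegral_mono' measurableSet_Ioo h2
    _ ≤ _ := by
        rw [h1]
        exact lintegral_mono_set Set.Ioo_subset_Ioi_self

/-- Point evaluations are bounded, locally uniformly. -/
theorem norm_apply_le (f : FockSpace) (w : ℂ) :
    ‖f w‖ ≤ Real.exp ((‖w‖ + 1) ^ 2 / 2) * ‖f‖ := by
  have hpi := Real.pi_pos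
  have h : ENNReal.ofReal Real.pi * ‖f w‖ₑ ^ 2 ≤
      ENNReal.ofReal (Real.exp ((‖w‖ + 1) ^ 2)) * ENNReal.ofReal (Real.pi * ‖f‖ ^ 2) := by
    rw [← lintegral_eq, ← lintegral_const_mul' _ _ ENNReal.ofReal_ne_top]
    refine (sq_norm_le_ball f.differentiable w).trans
      ((setLIntegral_mono' Metric.isClosed_closedBall.measurableSet fun z hz => ?_).trans
        (setLIntegral_le_lintegral (Metric.closedBall w 1) _))
    have hz' : ‖z‖ ≤ ‖w‖ + 1 := by
      have h1 := norm_le_norm_add_norm_sub' z w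
      have h2 : ‖z - w‖ ≤ 1 := by simpa [dist_eq_norm] using hz
      linarith
    have h1 : 1 ≤ Real.exp ((‖w‖ + 1) ^ 2) * Real.exp (-‖z‖ ^ 2) := by
      rw [← Real.exp_add]
      refine Real.one_le_exp ?_
      nlinarith [norm_nonneg z]
    calc ‖f z‖ₑ ^ 2 = ENNReal.ofReal 1 * ‖f z‖ₑ ^ 2 := by simp
      _ ≤ ENNReal.ofReal (Real.exp ((‖w‖ + 1) ^ 2) * Real.exp (-‖z‖ ^ 2)) * ‖f z‖ₑ ^ 2 := by
          gcongr
      _ = _ := by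
          rw [ENNReal.ofReal_mul (Real.exp_pos _).le]
          ring
  rw [← ofReal_norm, ← ENNReal.ofReal_pow (norm_nonneg _), ← ENNReal.ofReal_mul hpi.le,
    ← ENNReal.ofReal_mul (Real.exp_pos _).le, ENNReal.ofReal_le_ofReal_iff (by positivity)] at h
  have h2 : ‖f w‖ ^ 2 ≤ Real.exp ((‖w‖ + 1) ^ 2) * ‖f‖ ^ 2 := by
    refine le_of_mul_le_mul_left ?_ hpi
    linarith
  refine le_of_sq_le_sq ?_ (by positivity)
  rw [mul_pow, ← Real.exp_nat_mul, Nat.cast_ofNat, mul_div_cancel₀ _ two_ne_zero]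
  exact h2

/-- The Fock space is complete. -/
instance : CompleteSpace FockSpace := by
  refine Metric.complete_of_cauchySeq_tendsto fun u hu => ?_
  have hpi := Real.pi_pos
  have hpt : ∀ m n z, ‖u m z - u n z‖ ≤ Real.exp ((‖z‖ + 1) ^ 2 / 2) * ‖u m - u n‖ :=
    fun m n z => norm_apply_le (u m - u n) z
  have hcau : ∀ R : ℝ, UniformCauchySeqOn (fun n => (u n : ℂ → ℂ)) atTop (Metric.ball 0 R) := by
    intro R
    rw [Metric.uniformCauchySeqOn_iff]
    intro ε hε
    obtain ⟨N, hN⟩ := Metric.cauchySeq_iff.1 hu (ε / Real.exp ((R + 1) ^ 2 / 2)) (by positivity)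
    refine ⟨N, fun m hm n hn z hz => ?_⟩
    have hz' : ‖z‖ < R := by simpa using hz
    rw [dist_eq_norm]
    have h1 := hN m hm n hn
    rw [dist_eq_norm, lt_div_iff₀ (Real.exp_pos _)] at h1
    have h2 : Real.exp ((‖z‖ + 1) ^ 2 / 2) ≤ Real.exp ((R + 1) ^ 2 / 2) := by
      have := norm_nonneg z
      gcongr
    have h3 := hpt m n z
    nlinarith [norm_nonneg (u m - u n)]
  have hlim : ∀ z, ∃ l, Tendsto (fun n => u n z) atTop (𝓝 l) := fun z =>
    cauchySeq_tendsto_of_complete ((hcau (‖z‖ + 1)).cauchySeq (x := z) (by simp))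
  choose g hg using hlim
  have hgd : Differentiable ℂ g := by
    intro z
    have hT : TendstoLocallyUniformlyOn (fun n => (u n : ℂ → ℂ)) g atTop
        (Metric.ball 0 (‖z‖ + 1)) :=
      ((hcau _).tendstoUniformlyOn_of_tendsto fun x _ => hg x).tendstoLocallyUniformlyOn
    have := hT.differentiableOn (Eventually.of_forall fun n => (u n).differentiable.differentiableOn)
      Metric.isOpen_ball
    exact this.differentiableAt (Metric.isOpen_ball.mem_nhds (by simp))
  have hgc := hgd.continuous
  have hfatou : ∀ ε > 0, ∃ N, ∀ n ≥ N,
      ∫⁻ z : ℂ, ‖u n z - g z‖ₑ ^ 2 * ENNReal.ofReal (Real.exp (-‖z‖ ^ 2)) ≤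
        ENNReal.ofReal (Real.pi * ε ^ 2) := by
    intro ε hε
    obtain ⟨N, hN⟩ := Metric.cauchySeq_iff.1 hu ε hε
    refine ⟨N, fun n hn => ?_⟩
    have hlin : ∀ z, Tendsto
        (fun m => ‖u n z - u m z‖ₑ ^ 2 * ENNReal.ofReal (Real.exp (-‖z‖ ^ 2))) atTop
        (𝓝 (‖u n z - g z‖ₑ ^ 2 * ENNReal.ofReal (Real.exp (-‖z‖ ^ 2)))) := fun z =>
      ENNReal.Tendsto.mul_const
        (((ENNReal.continuous_pow 2).tendsto _).comp ((hg z).const_sub (u n z)).enorm)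
        (Or.inr ENNReal.ofReal_ne_top)
    calc ∫⁻ z : ℂ, ‖u n z - g z‖ₑ ^ 2 * ENNReal.ofReal (Real.exp (-‖z‖ ^ 2))
        = ∫⁻ z : ℂ, liminf
            (fun m => ‖u n z - u m z‖ₑ ^ 2 * ENNReal.ofReal (Real.exp (-‖z‖ ^ 2))) atTop := by
          congr 1
          funext z
          exact (hlin z).liminf_eq.symm
      _ ≤ liminf (fun m => ∫⁻ z : ℂ,
            ‖u n z - u m z‖ₑ ^ 2 * ENNReal.ofReal (Real.exp (-‖z‖ ^ 2))) atTop := by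
          refine lintegral_liminf_le fun m => ?_
          have h1 := (u n).differentiable.continuous
          have h2 := (u m).differentiable.continuous
          fun_prop
      _ ≤ ENNReal.ofReal (Real.pi * ε ^ 2) := by
          refine liminf_le_of_frequently_le' (Eventually.frequently ?_)
          filter_upwards [eventually_ge_atTop N] with m hm
          have h1 := lintegral_eq (u n - u m)
          simp only [sub_apply] at h1
          rw [h1]
          have h2 := (hN n hn m hm).le
          rw [dist_eq_norm] at h2
          gcongr
  have hint : ∀ n, ∫⁻ z : ℂ, ‖u n z - g z‖ₑ ^ 2 * ENNReal.ofReal (Real.exp (-‖z‖ ^ 2)) < ⊤ →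
      GaussSqIntegrable (fun z => u n z - g z) := by
    intro n hn
    have h1 := (u n).differentiable.continuous
    refine ⟨Continuous.aestronglyMeasurable (by fun_prop), ?_⟩
    rw [hasFiniteIntegral_iff_ofReal (Eventually.of_forall fun z => by positivity)]
    refine lt_of_le_of_lt (le_of_eq ?_) hn
    congr 1
    funext z
    rw [ENNReal.ofReal_mul (by positivity), ENNReal.ofReal_pow (norm_nonneg _), ofReal_norm]
  have hgmem : g ∈ fockSubmodule := by
    obtain ⟨N, hN⟩ := hfatou 1 one_pos
    have h1 : (fun z => u N z - g z) ∈ fockSubmodule :=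
      ⟨(u N).differentiable.sub hgd, hint N ((hN N le_rfl).trans_lt ENNReal.ofReal_lt_top)⟩
    have h2 := fockSubmodule.sub_mem (u N).mem h1
    have h3 : ((u N : ℂ → ℂ) - fun z => u N z - g z) = g := by
      funext z
      simp
    rwa [h3] at h2
  refine ⟨mk g hgmem, ?_⟩
  rw [Metric.tendsto_atTop]
  intro ε hε
  obtain ⟨N, hN⟩ := hfatou (ε / 2) (by positivity)
  refine ⟨N, fun n hn => ?_⟩
  have h1 := lintegral_eq (u n - mk g hgmem)
  simp only [sub_apply, mk_apply] at h1
  have h2 := hN n hn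
  rw [h1, ENNReal.ofReal_le_ofReal_iff (by positivity)] at h2
  have h3 : ‖u n - mk g hgmem‖ ≤ ε / 2 :=
    le_of_sq_le_sq (le_of_mul_le_mul_left h2 hpi) (by positivity)
  rw [dist_eq_norm]
  linarith

end FockSpace

/-! ## Weighted composition operators and cohyponormality -/

/-- The maximal weighted composition operator `f ↦ ψ · (f ∘ φ)` on the Fock space, with domain
all `f` in the Fock space for which `ψ · (f ∘ φ)` is in the Fock space. -/
def maxWeightedComp (ψ φ : ℂ → ℂ) : FockSpace →ₗ.[ℂ] FockSpace where
  domain :=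
    { carrier := {f | (fun z => ψ z * f (φ z)) ∈ fockSubmodule}
      zero_mem' := by
        have h : (fun z => ψ z * (0 : FockSpace) (φ z)) = 0 := by ext z; simp
        simpa only [Set.mem_ofPred_eq, h] using fockSubmodule.zero_mem
      add_mem' := fun {f g} hf hg => by
        have h : (fun z => ψ z * (f + g) (φ z)) =
            (fun z => ψ z * f (φ z)) + fun z => ψ z * g (φ z) := by
          ext z; simp [mul_add]
        simpa only [Set.mem_ofPred_eq, h] using fockSubmodule.add_mem hf hg
      smul_mem' := fun c f hf => by
        have h : (fun z => ψ z * (c • f) (φ z)) = c • fun z => ψ z * f (φ z) := by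
          ext z; simp [mul_left_comm]
        simpa only [Set.mem_ofPred_eq, h] using fockSubmodule.smul_mem c hf }
  toFun :=
    { toFun := fun f => FockSpace.mk (fun z => ψ z * (f : FockSpace) (φ z)) f.2
      map_add' := fun f g => by ext z; simp [mul_add]
      map_smul' := fun c f => by ext z; simp [mul_left_comm] }

/-- A closed densely defined operator `T` on a Hilbert space is cohyponormal if
`dom T† ⊆ dom T` and `‖T x‖ ≤ ‖T† x‖` for all `x ∈ dom T†`. -/
def IsCohyponormal {H : Type*} [NormedAddCommGroup H] [InnerProductSpace ℂ H] [CompleteSpace H]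
    (T : H →ₗ.[ℂ] H) : Prop :=
  T.IsClosed ∧ Dense (T.domain : Set H) ∧
    ∃ h : T†.domain ≤ T.domain, ∀ x : T†.domain, ‖T (Submodule.inclusion h x)‖ ≤ ‖T† x‖

end

/-! Write `T` for the operator and `K_z` for the reproducing kernel at `z`. The argument tests
cohyponormality on kernels, where the adjoint is explicit: `T† K_z = conj (ψ z) • K_{φ z}`.

Necessity: `‖T K_z‖ ≤ ‖T† K_z‖`, combined with the sharp bound for evaluation at `w`, is an
inequality between `ψ` and `φ` valid for all `z` and `w` (`IsCohyponormal.norm_mul_exp_le`). It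
makes `ψ` zero-free, so `ψ = exp p`. After taking logarithms, fixing `z` bounds the real parts of
`p` and `φ` quadratically, so both are polynomials of degree at most two. Comparing growth removes
both quadratic terms. At the optimal `w`, what remains is affine in `z`; it forces `D (1 - conj A) =
conj B (1 - A)` and `‖D‖ ≤ ‖B‖`. The first relation is void for `A = 1` and implies `‖D‖ = ‖B‖`
otherwise, hence the two cases.

Sufficiency: `T†` acts on its domain by a formula of the same affine-exponential shape. For `A ≠ 0`
a rigid motion of the plane aligns the arguments of `g` in `T g` and `T† g`. Under the two relations
the integrands then compare pointwise, which gives both the domain inclusion and the norm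
inequality. -/

/-! ## Polynomial growth -/

/-- An entire function whose real part grows at most quadratically is a quadratic polynomial. -/
theorem Complex.exists_quadratic_of_re_le {f : ℂ → ℂ} (hf : Differentiable ℂ f) {C : ℝ}
    (hC : ∀ z, (f z).re ≤ C * (1 + ‖z‖ ^ 2)) :
    ∃ a b c : ℂ, ∀ z, f z = a * z ^ 2 + b * z + c := by
  set M : ℝ := |C| + 1 with hM
  have hMpos : 0 < M := by positivity
  -- Borel–Carathéodory on the disc of radius `2 * r` turns the one-sided bound into a bound for
  -- `‖f‖`; `1 ≤ r` absorbs the constants, `2 * M * (1 + 4 * r ^ 2) ≤ 10 * M * r ^ 2`.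
  have hbound : ∀ r : ℝ, 1 ≤ r → ∀ z : ℂ, ‖z‖ = r → ‖f z‖ ≤ (10 * M + 3 * ‖f 0‖) * r ^ 2 := by
    intro r hr z hz
    have hb := Complex.borelCaratheodory (f := f) (M := M * (1 + (2 * r) ^ 2)) (R := 2 * r)
      (z := z) (by positivity) hf.differentiableOn (fun w hw => ?_) (by linarith)
      (by simp [hz]; linarith)
    · rw [hz, show 2 * r - r = r by ring, show 2 * r + r = 3 * r by ring] at hb
      have h1 : 2 * (M * (1 + (2 * r) ^ 2)) * r / r + ‖f 0‖ * (3 * r) / r =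
          2 * (M * (1 + (2 * r) ^ 2)) + 3 * ‖f 0‖ := by
        field_simp
      rw [h1] at hb
      have h2 : 1 ≤ r ^ 2 := by nlinarith
      nlinarith [norm_nonneg (f 0), mul_le_mul_of_nonneg_left h2 hMpos.le,
        mul_le_mul_of_nonneg_left h2 (norm_nonneg (f 0))]
    · have hw' : ‖w‖ ≤ 2 * r := by simpa using (Metric.mem_ball.1 hw).le
      have h3 : ‖w‖ ^ 2 ≤ (2 * r) ^ 2 := by gcongr
      calc (f w).re ≤ C * (1 + ‖w‖ ^ 2) := hC w
        _ ≤ M * (1 + ‖w‖ ^ 2) := by gcongr; linarith [le_abs_self C]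
        _ ≤ _ := by gcongr
  have hzero : ∀ n : ℕ, 3 ≤ n → iteratedDeriv n f 0 = 0 := by
    intro n hn
    by_contra hne
    have hpos : 0 < ‖iteratedDeriv n f 0‖ := norm_pos_iff.2 hne
    set K : ℝ := n.factorial * (10 * M + 3 * ‖f 0‖) with hK
    have hKpos : 0 < K := by positivity
    -- Large enough to contradict the Cauchy estimate, which gives `‖iteratedDeriv n f 0‖ * r ≤ K`
    -- once `n ≥ 3`.
    set r : ℝ := max 1 (2 * K / ‖iteratedDeriv n f 0‖) with hr
    have hr1 : 1 ≤ r := le_max_left _ _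
    have hr0 : 0 < r := by linarith
    have h := Complex.norm_iteratedDeriv_le_of_forall_mem_sphere_norm_le (c := 0) n hr0
      hf.diffContOnCl (fun z hz => hbound r hr1 z (by simpa using hz))
    rw [le_div_iff₀ (by positivity)] at h
    have h1 : r ^ 3 ≤ r ^ n := pow_le_pow_right₀ hr1 hn
    have h2 : 2 * K ≤ r * ‖iteratedDeriv n f 0‖ := by
      rw [← div_le_iff₀ hpos]
      exact le_max_right _ _
    have h3 : ‖iteratedDeriv n f 0‖ * r ^ 3 ≤ K * r ^ 2 := by
      calc _ ≤ ‖iteratedDeriv n f 0‖ * r ^ n := by gcongr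
        _ ≤ _ := h
        _ = K * r ^ 2 := by rw [hK]; ring
    nlinarith [mul_le_mul_of_nonneg_left h2 (sq_nonneg r), mul_pos hKpos (pow_pos hr0 2)]
  refine ⟨(2 : ℂ)⁻¹ * iteratedDeriv 2 f 0, iteratedDeriv 1 f 0, f 0, fun z => ?_⟩
  have h1 := Complex.hasSum_taylorSeries_of_entire hf 0 z
  have h2 := h1.unique (hasSum_sum_of_ne_finset_zero (s := Finset.range 3) fun n hn => by
    rw [hzero n (by simpa using hn)]; simp)
  rw [h2]
  simp [Finset.sum_range_succ]
  ring

/-- A zero-free entire function has an entire logarithm. -/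
theorem exists_eq_exp_of_differentiable {f : ℂ → ℂ} (hf : Differentiable ℂ f) (h0 : ∀ z, f z ≠ 0) :
    ∃ p : ℂ → ℂ, Differentiable ℂ p ∧ ∀ z, f z = Complex.exp (p z) := by
  have hd : Differentiable ℂ (fun z => deriv f z / f z) := hf.deriv.div hf h0
  obtain ⟨p, hp0, hp⟩ := hd.isExactOn_univ.with_val_at 0 (Complex.log (f 0))
  have hp' : ∀ z, HasDerivAt p (deriv f z / f z) z := fun z => hp z trivial
  have hpd : Differentiable ℂ p := fun z => (hp' z).differentiableAt
  refine ⟨p, hpd, fun z => ?_⟩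
  have hq : ∀ z, HasDerivAt (fun z => f z * Complex.exp (-p z)) 0 z := fun z => by
    have h := (hf z).hasDerivAt.mul (hp' z).neg.cexp
    refine h.congr_deriv ?_
    field_simp [h0 z]
    ring
  have hconst := is_const_of_deriv_eq_zero (fun z => (hq z).differentiableAt)
    (fun z => (hq z).deriv) z 0
  simp only [hp0, Complex.exp_neg, Complex.exp_log (h0 0), mul_inv_cancel₀ (h0 0)] at hconst
  rwa [← div_eq_mul_inv, div_eq_one_iff_eq (Complex.exp_ne_zero _)] at hconst

theorem nonpos_of_forall_quadratic_nonpos {x y c : ℝ}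
    (h : ∀ t : ℝ, x * t ^ 2 + y * t + c ≤ 0) : x ≤ 0 := by
  by_contra! hx
  -- With this `t ≥ 1`, `x * t ^ 2 = t * (|y| + |c| + 1 + x)` exceeds `|y| * t + |c|`.
  have h1 := h ((|y| + |c| + 1) / x + 1)
  have h2 := h (-((|y| + |c| + 1) / x + 1))
  set t := (|y| + |c| + 1) / x + 1 with ht
  have h3 : x * t = |y| + |c| + 1 + x := by rw [ht]; field_simp
  have h4 : 1 ≤ t := by rw [ht]; linarith [show 0 ≤ (|y| + |c| + 1) / x by positivity]
  nlinarith [neg_abs_le c, abs_nonneg y, abs_nonneg c, neg_abs_le y]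

theorem eq_zero_of_forall_linear_nonpos {y c : ℝ} (h : ∀ t : ℝ, y * t + c ≤ 0) : y = 0 := by
  by_contra hy
  have h1 := h ((1 - c) / y)
  rw [mul_div_cancel₀ _ hy] at h1
  linarith

theorem eq_zero_of_forall_re_mul_add_nonpos {y : ℂ} {c : ℝ} (h : ∀ z : ℂ, (y * z).re + c ≤ 0) :
    y = 0 := by
  have h1 := eq_zero_of_forall_linear_nonpos (y := Complex.normSq y) (c := c) fun t => by
    have := h (conj y * t)
    rwa [← mul_assoc, Complex.mul_conj, ← Complex.ofReal_mul, Complex.ofReal_re] at this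
  exact Complex.normSq_eq_zero.1 h1

theorem eq_zero_of_forall_re_mul_sq_nonpos {y : ℂ} (h : ∀ z : ℂ, (y * z ^ 2).re ≤ 0) : y = 0 := by
  obtain ⟨z, hz⟩ := IsAlgClosed.exists_pow_nat_eq (conj y) (n := 2) two_pos
  have h1 := h z
  rw [hz, Complex.mul_conj, Complex.ofReal_re] at h1
  exact Complex.normSq_eq_zero.1 (le_antisymm h1 (Complex.normSq_nonneg y))

/-! ## Reproducing kernels -/

theorem integrable_exp_neg_norm_sq : Integrable (fun z : ℂ => Real.exp (-‖z‖ ^ 2)) volume := by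
  have h := (GaussianFourier.integrable_cexp_neg_mul_sq_norm_add (V := ℂ) (b := 1) (by simp) 0
    0).norm
  refine h.congr (Eventually.of_forall fun z => ?_)
  simp [Complex.norm_exp, ← Complex.ofReal_pow]

/-- The Gaussian mean value property of entire functions. -/
theorem integral_mul_exp_neg_norm_sq {h : ℂ → ℂ} (hd : Differentiable ℂ h)
    (hi : Integrable (fun z : ℂ => h z * (Real.exp (-‖z‖ ^ 2) : ℂ)) volume) :
    ∫ z : ℂ, h z * (Real.exp (-‖z‖ ^ 2) : ℂ) = Real.pi * h 0 := by
  have hpi := Real.pi_pos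
  have hc := hd.continuous
  set F : ℂ → ℂ := fun z => h z * (Real.exp (-‖z‖ ^ 2) : ℂ) with hF
  have hFc : Continuous F := by fun_prop
  have hpol : ∀ p : ℝ × ℝ, Complex.polarCoord.symm p = circleMap 0 p.1 p.2 := fun p => by
    rw [Complex.polarCoord_symm_apply, circleMap, Complex.exp_mul_I]
    simp
  have hcm : Continuous fun p : ℝ × ℝ => circleMap 0 p.1 p.2 := by
    simp only [circleMap]
    fun_prop
  have hpi_int : IntegrableOn (fun p : ℝ × ℝ => p.1 • F (circleMap 0 p.1 p.2))
      (Set.Ioi (0 : ℝ) ×ˢ Set.Ioo (-Real.pi) Real.pi) := by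
    refine ⟨(Continuous.aestronglyMeasurable (by fun_prop)), ?_⟩
    have h1 := Complex.lintegral_comp_polarCoord_symm (fun z => ‖F z‖ₑ)
    have h2 := hi.2
    rw [HasFiniteIntegral] at h2 ⊢
    rw [← h1, polarCoord_target] at h2
    refine lt_of_le_of_lt (le_of_eq ?_) h2
    refine setLIntegral_congr_fun (measurableSet_Ioi.prod measurableSet_Ioo) fun p hp => ?_
    have hp1 : 0 < p.1 := hp.1
    simp only [hpol, enorm_smul, smul_eq_mul]
    rw [← ofReal_norm p.1, Real.norm_of_nonneg hp1.le]
  -- The weight is radial, so on each circle the mean value property replaces `h` by `h 0`.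
  have hinner : ∀ r : ℝ, 0 < r → ∫ θ in Set.Ioo (-Real.pi) Real.pi, r • F (circleMap 0 r θ) =
      ((r * Real.exp (-r ^ 2) : ℝ) : ℂ) * (2 * Real.pi * h 0) := by
    intro r hr
    have hmv := DiffContOnCl.circleAverage (f := h) (c := 0) (R := r) hd.diffContOnCl
    rw [Real.circleAverage] at hmv
    have hper : Function.Periodic (fun θ => h (circleMap 0 r θ)) (2 * Real.pi) := fun θ => by
      simp only [periodic_circleMap 0 r θ]
    have hshift := hper.intervalIntegral_add_eq 0 (-Real.pi)
    rw [zero_add, show -Real.pi + 2 * Real.pi = Real.pi by ring] at hshift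
    rw [hshift, intervalIntegral.integral_of_le (by linarith), integral_Ioc_eq_integral_Ioo] at hmv
    rw [← hmv]
    have h3 : ∀ θ, r • F (circleMap 0 r θ) =
        ((r * Real.exp (-r ^ 2) : ℝ) : ℂ) * h (circleMap 0 r θ) := fun θ => by
      have hn : ‖circleMap 0 r θ‖ = r := by simp [abs_of_pos hr]
      simp only [hF, hn, Complex.real_smul]
      push_cast
      ring
    simp only [h3]
    rw [integral_const_mul, Complex.real_smul]
    push_cast
    field_simp
  have hrad : ∫ r in Set.Ioi (0 : ℝ), r * Real.exp (-r ^ 2) = 1 / 2 := by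
    have := integral_rpow_mul_exp_neg_rpow (p := 2) (q := 1) (by norm_num) (by norm_num)
    simpa [Real.rpow_ofNat] using this
  rw [← Complex.integral_comp_polarCoord_symm]
  simp only [hpol]
  rw [polarCoord_target, Measure.volume_eq_prod, setIntegral_prod _ hpi_int,
    setIntegral_congr_fun measurableSet_Ioi fun r hr => hinner r hr, integral_mul_const,
    integral_complex_ofReal, hrad]
  push_cast
  ring

namespace FockSpace

/-- Completing the square, the weighted square modulus is `exp (‖w‖ ^ 2)` times the Gaussian centred
at `w`. -/
theorem exp_mul_conj_mem (w : ℂ) : (fun z => Complex.exp (z * conj w)) ∈ fockSubmodule := by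
  refine ⟨by fun_prop, ?_⟩
  refine ((integrable_exp_neg_norm_sq.comp_sub_right w).const_mul (Real.exp (‖w‖ ^ 2))).congr
    (Eventually.of_forall fun z => ?_)
  simp only [Complex.norm_exp]
  rw [← Real.exp_nat_mul, ← Real.exp_add, ← Real.exp_add]
  congr 1
  simp only [← Complex.normSq_eq_norm_sq, Complex.normSq_apply, Complex.mul_re, Complex.conj_re,
    Complex.conj_im, Complex.sub_re, Complex.sub_im]
  push_cast
  ring

/-- The reproducing kernel of the Fock space at `w`. -/
noncomputable def kernel (w : ℂ) : FockSpace := mk (fun z => Complex.exp (z * conj w)) (exp_mul_conj_mem w)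

@[simp] theorem kernel_apply (w z : ℂ) : kernel w z = Complex.exp (z * conj w) := rfl

/-- Translation by `w` cancels the antiholomorphic factor of the kernel against the Gaussian. What
is left is the entire function `f (z + w) * exp (-(z * conj w))`, whose Gaussian mean is its value
at `0`. -/
theorem inner_kernel (w : ℂ) (f : FockSpace) : inner ℂ (kernel w) f = f w := by
  have hpi := Real.pi_pos
  have hfd := f.differentiable
  have key : ∀ z, f (z + w) * conj (kernel w (z + w)) * (Real.exp (-‖z + w‖ ^ 2) : ℂ) =
      f (z + w) * Complex.exp (-(z * conj w)) * (Real.exp (-‖z‖ ^ 2) : ℂ) := fun z => by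
    rw [kernel_apply, ← Complex.exp_conj, mul_assoc, mul_assoc, Complex.ofReal_exp,
      Complex.ofReal_exp, ← Complex.exp_add, ← Complex.exp_add]
    congr 2
    push_cast
    rw [← Complex.mul_conj', ← Complex.mul_conj']
    simp only [map_mul, map_add, Complex.conj_conj]
    ring
  have hint := (integrable_pairing f (kernel w)).comp_add_right w
  simp only [key] at hint
  rw [inner_def, ← integral_add_right_eq_self _ w]
  simp only [key]
  rw [integral_mul_exp_neg_norm_sq (h := fun z => f (z + w) * Complex.exp (-(z * conj w)))
    (by fun_prop) hint]
  simp

theorem norm_kernel (w : ℂ) : ‖kernel w‖ = Real.exp (‖w‖ ^ 2 / 2) := by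
  have h := inner_self_eq_norm_sq (𝕜 := ℂ) (kernel w)
  rw [inner_kernel, kernel_apply, Complex.mul_conj', RCLike.re_to_complex, ← Complex.ofReal_pow,
    ← Complex.ofReal_exp, Complex.ofReal_re] at h
  rw [← sq_eq_sq₀ (norm_nonneg _) (Real.exp_pos _).le, ← h, ← Real.exp_nat_mul]
  congr 1
  push_cast
  ring

/-- Cauchy–Schwarz against the kernel. The sharp exponent `‖w‖ ^ 2 / 2` is what later lets the
squares be completed exactly. -/
theorem norm_apply_le_exp (f : FockSpace) (w : ℂ) : ‖f w‖ ≤ Real.exp (‖w‖ ^ 2 / 2) * ‖f‖ := by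
  rw [← inner_kernel, ← norm_kernel]
  exact norm_inner_le_norm _ _

theorem tendsto_apply {u : ℕ → FockSpace} {f : FockSpace} (h : Tendsto u atTop (𝓝 f)) (z : ℂ) :
    Tendsto (fun n => u n z) atTop (𝓝 (f z)) := by
  simp only [← inner_kernel]
  exact tendsto_const_nhds.inner h

/-- A subspace containing all reproducing kernels is dense. -/
theorem dense_of_kernel_mem {S : Submodule ℂ FockSpace} (h : ∀ w, kernel w ∈ S) :
    Dense (S : Set FockSpace) := by
  rw [Submodule.dense_iff_topologicalClosure_eq_top, Submodule.topologicalClosure_eq_top_iff,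
    Submodule.eq_bot_iff]
  intro f hf
  ext w
  rw [← inner_kernel]
  exact (Submodule.mem_orthogonal _ _).1 hf _ (h w)

end FockSpace

/-! ## Consequences of cohyponormality -/

@[simp] theorem maxWeightedComp_apply (ψ φ : ℂ → ℂ) (f : (maxWeightedComp ψ φ).domain) (z : ℂ) :
    maxWeightedComp ψ φ f z = ψ z * (f : FockSpace) (φ z) := rfl

/-- Norm convergence implies pointwise convergence, which identifies the limit of the images;
maximality of the domain then admits the limit function. -/
theorem isClosed_maxWeightedComp {ψ φ : ℂ → ℂ} : (maxWeightedComp ψ φ).IsClosed := by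
  refine IsSeqClosed.isClosed fun u p hu hp => ?_
  have h1 : Tendsto (fun n => (u n).1) atTop (𝓝 p.1) := (continuous_fst.tendsto p).comp hp
  have h2 : Tendsto (fun n => (u n).2) atTop (𝓝 p.2) := (continuous_snd.tendsto p).comp hp
  have h3 : (fun z => ψ z * p.1 (φ z)) = p.2 := by
    funext z
    refine tendsto_nhds_unique ((FockSpace.tendsto_apply h1 (φ z)).const_mul (ψ z))
      ((FockSpace.tendsto_apply h2 z).congr fun n => ?_)
    obtain ⟨x, hx1, hx2⟩ := (LinearPMap.mem_graph_iff _).1 (hu n)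
    rw [← hx1, ← hx2, maxWeightedComp_apply]
  have h4 : p.1 ∈ (maxWeightedComp ψ φ).domain := by
    change (fun z => ψ z * p.1 (φ z)) ∈ fockSubmodule
    rw [h3]
    exact p.2.mem
  exact (LinearPMap.mem_graph_iff _).2 ⟨⟨p.1, h4⟩, rfl, FockSpace.ext fun z => congrFun h3 z⟩

/-- The weak form of `T† K_z = conj (ψ z) • K_{φ z}`: both sides equal `ψ z * f (φ z)`. -/
theorem inner_smul_kernel_eq_inner_kernel_maxWeightedComp (ψ φ : ℂ → ℂ) (z : ℂ)
    (f : (maxWeightedComp ψ φ).domain) :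
    inner ℂ (conj (ψ z) • FockSpace.kernel (φ z)) (f : FockSpace) =
      inner ℂ (FockSpace.kernel z) (maxWeightedComp ψ φ f) := by
  rw [inner_smul_left, FockSpace.inner_kernel, FockSpace.inner_kernel, Complex.conj_conj,
    maxWeightedComp_apply]

/-- Cohyponormality is applied to `K_z`, and `T K_z` is then evaluated at `w`. -/
theorem IsCohyponormal.norm_mul_exp_le {ψ φ : ℂ → ℂ} (h : IsCohyponormal (maxWeightedComp ψ φ))
    (z w : ℂ) :
    ‖ψ w‖ * Real.exp ((φ w * conj z).re) ≤
      Real.exp (‖w‖ ^ 2 / 2) * (‖ψ z‖ * Real.exp (‖φ z‖ ^ 2 / 2)) := by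
  obtain ⟨-, hd, hle, hn⟩ := h
  have hadj := inner_smul_kernel_eq_inner_kernel_maxWeightedComp ψ φ z
  have hmem : FockSpace.kernel z ∈ (maxWeightedComp ψ φ)†.domain :=
    LinearPMap.mem_adjoint_domain_of_exists _ ⟨_, hadj⟩
  have hval := LinearPMap.adjoint_apply_eq hd ⟨_, hmem⟩ hadj
  have h1 := hn ⟨_, hmem⟩
  rw [hval, norm_smul, RCLike.norm_conj, FockSpace.norm_kernel] at h1
  refine le_trans (le_of_eq ?_) ((FockSpace.norm_apply_le_exp _ w).trans
    (mul_le_mul_of_nonneg_left h1 (Real.exp_pos _).le))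
  simp [Complex.norm_exp]

/-- The two algebraic relations between the coefficients that encode cohyponormality. -/
theorem IsCohyponormal.exists_coeff {ψ φ : ℂ → ℂ} (hψ : Differentiable ℂ ψ)
    (hφ : Differentiable ℂ φ) (hψ0 : ψ ≠ 0) (h : IsCohyponormal (maxWeightedComp ψ φ)) :
    ∃ A B C D : ℂ, (∀ z, φ z = A * z + B) ∧ (∀ z, ψ z = C * Complex.exp (D * z)) ∧
      D + A * conj B = D * conj A + conj B ∧ ‖D‖ ≤ ‖B‖ := by
  -- A zero at `z` makes the right side of the kernel inequality vanish for every `w`, so `ψ = 0`.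
  have hne : ∀ z, ψ z ≠ 0 := by
    intro z hz
    refine hψ0 (funext fun w => ?_)
    have h1 := h.norm_mul_exp_le z w
    rw [hz, norm_zero, zero_mul, mul_zero] at h1
    have h2 : ‖ψ w‖ ≤ 0 := by
      by_contra! h3
      exact absurd h1 (not_le.2 (mul_pos h3 (Real.exp_pos _)))
    simpa using h2
  obtain ⟨p, hp, hψp⟩ := exists_eq_exp_of_differentiable hψ hne
  have hmain : ∀ z w : ℂ, (p w).re + (φ w * conj z).re - ‖w‖ ^ 2 / 2 ≤
      (p z).re + ‖φ z‖ ^ 2 / 2 := by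
    intro z w
    have h1 := h.norm_mul_exp_le z w
    rw [hψp, hψp, Complex.norm_exp, Complex.norm_exp, ← Real.exp_add, ← Real.exp_add,
      ← Real.exp_add, Real.exp_le_exp] at h1
    linarith
  -- At `z = 0` the term in `φ w` disappears, leaving an upper bound for `(p w).re`.
  obtain ⟨α, D, γ, hpq⟩ := Complex.exists_quadratic_of_re_le hp
    (C := 1 + |(p 0).re + ‖φ 0‖ ^ 2 / 2|) fun w => by
      have h1 := hmain 0 w
      simp only [map_zero, mul_zero, Complex.zero_re] at h1
      have h2 := le_abs_self ((p 0).re + ‖φ 0‖ ^ 2 / 2)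
      nlinarith [sq_nonneg ‖w‖, abs_nonneg ((p 0).re + ‖φ 0‖ ^ 2 / 2),
        mul_nonneg (abs_nonneg ((p 0).re + ‖φ 0‖ ^ 2 / 2)) (sq_nonneg ‖w‖)]
  -- At `z = 1` the term is `(φ w).re`; since `p` is already quadratic, `-(p w).re` grows at most
  -- quadratically.
  obtain ⟨a, A, B, hφq⟩ := Complex.exists_quadratic_of_re_le hφ
    (C := |(p 1).re + ‖φ 1‖ ^ 2 / 2| + 1 + ‖α‖ + ‖D‖ + ‖γ‖) fun w => by
      have h1 := hmain 1 w
      simp only [map_one, mul_one] at h1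
      have h2 := le_abs_self ((p 1).re + ‖φ 1‖ ^ 2 / 2)
      have h3 : -(p w).re ≤ ‖α‖ * ‖w‖ ^ 2 + ‖D‖ * ‖w‖ + ‖γ‖ := by
        refine ((neg_le_abs _).trans (Complex.abs_re_le_norm _)).trans ?_
        rw [hpq]
        refine (norm_add₃_le).trans (le_of_eq ?_)
        simp
      have h4 : ‖w‖ ≤ 1 + ‖w‖ ^ 2 := by nlinarith [sq_nonneg (‖w‖ - 1), norm_nonneg w]
      have h5 := mul_le_mul_of_nonneg_left h4 (norm_nonneg D)
      nlinarith [sq_nonneg ‖w‖, norm_nonneg α, norm_nonneg γ,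
        mul_nonneg (norm_nonneg γ) (sq_nonneg ‖w‖),
        mul_nonneg (abs_nonneg ((p 1).re + ‖φ 1‖ ^ 2 / 2)) (sq_nonneg ‖w‖)]
  have ha : a = 0 := by
    -- Take `z = s * a` and `w = t` real: this is the coefficient of `t ^ 2`, and it must be
    -- nonpositive for every `s`.
    have h1 : ∀ s : ℝ, Complex.normSq a * s + (α.re - 1 / 2) ≤ 0 := fun s =>
      nonpos_of_forall_quadratic_nonpos (y := D.re + s * (A * conj a).re)
        (c := γ.re + s * (B * conj a).re - ((p (s * a)).re + ‖φ (s * a)‖ ^ 2 / 2)) fun t => by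
          have h2 := hmain (s * a) t
          have h3 : (p t).re = α.re * t ^ 2 + D.re * t + γ.re := by
            rw [hpq, ← Complex.ofReal_pow]
            simp only [Complex.add_re, Complex.re_mul_ofReal]
          have h4 : (φ t * conj (s * a)).re = Complex.normSq a * s * t ^ 2 +
              s * (A * conj a).re * t + s * (B * conj a).re := by
            have h5 : φ t * conj (s * a) = ((Complex.normSq a * s * t ^ 2 : ℝ) : ℂ) +
                ((s * t : ℝ) : ℂ) * (A * conj a) + (s : ℂ) * (B * conj a) := by
              rw [hφq]
              push_cast
              rw [← Complex.mul_conj]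
              simp only [map_mul, Complex.conj_ofReal]
              ring
            rw [h5, Complex.add_re, Complex.add_re, Complex.re_ofReal_mul, Complex.re_ofReal_mul,
              Complex.ofReal_re]
            ring
          rw [h3, h4, Complex.norm_real, Real.norm_eq_abs, sq_abs] at h2
          linarith
    exact Complex.normSq_eq_zero.1 (eq_zero_of_forall_linear_nonpos h1)
  have hφ1 : ∀ z, φ z = A * z + B := fun z => by rw [hφq, ha]; ring
  -- Scaling `(z, w)` to `(t * z, t * w)` isolates the homogeneous quadratic part.
  have hquad : ∀ z w : ℂ, (α * w ^ 2).re + (A * w * conj z).re - ‖w‖ ^ 2 / 2 - (α * z ^ 2).re -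
      ‖A * z‖ ^ 2 / 2 ≤ 0 := fun z w =>
    nonpos_of_forall_quadratic_nonpos
      (y := (D * w).re + (B * conj z).re - (D * z).re - (A * z * conj B).re)
      (c := -(‖B‖ ^ 2 / 2)) fun t => by
        have h1 := hmain (t * z) (t * w)
        rw [hpq, hpq, hφ1, hφ1] at h1
        simp only [← Complex.normSq_eq_norm_sq] at h1 ⊢
        simp only [Complex.normSq_apply, Complex.add_re, Complex.add_im, Complex.mul_re,
          Complex.mul_im, pow_two, Complex.ofReal_re, Complex.ofReal_im, Complex.conj_re,
          Complex.conj_im] at h1 ⊢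
        linarith
  -- The terms without `α` in `hquad` form the perfect square `-‖w - conj A * z‖ ^ 2 / 2`, hence the
  -- substitution `w = conj A * z + h`.
  have hquad' : ∀ z h : ℂ, (α * (conj A * z + h) ^ 2).re - (α * z ^ 2).re - ‖h‖ ^ 2 / 2 ≤ 0 :=
    fun z h => by
      have h1 := hquad z (conj A * z + h)
      simp only [← Complex.normSq_eq_norm_sq] at h1 ⊢
      simp only [Complex.normSq_apply, Complex.add_re, Complex.add_im, Complex.mul_re,
        Complex.mul_im, pow_two, Complex.conj_re, Complex.conj_im] at h1 ⊢
      linarith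
  have hα1 : ∀ u : ℂ, ∀ t : ℝ, (α * ((conj A) ^ 2 - 1) * u ^ 2).re * t ^ 2 +
      (2 * (α * conj A * u)).re * t + (α.re - 1 / 2) ≤ 0 := fun u t => by
    have h1 := hquad' (t * u) 1
    rw [norm_one] at h1
    have h2 : α * (conj A * (t * u) + 1) ^ 2 = ((t ^ 2 : ℝ) : ℂ) * (α * (conj A) ^ 2 * u ^ 2) +
        (t : ℂ) * (2 * (α * conj A * u)) + α := by
      push_cast
      ring
    have h3 : α * (t * u) ^ 2 = ((t ^ 2 : ℝ) : ℂ) * (α * u ^ 2) := by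
      push_cast
      ring
    have h4 : α * ((conj A) ^ 2 - 1) * u ^ 2 = α * (conj A) ^ 2 * u ^ 2 - α * u ^ 2 := by ring
    rw [h2, h3, Complex.add_re, Complex.add_re, Complex.re_ofReal_mul, Complex.re_ofReal_mul,
      Complex.re_ofReal_mul] at h1
    rw [h4, Complex.sub_re]
    linarith
  have hα2 : α * ((conj A) ^ 2 - 1) = 0 :=
    eq_zero_of_forall_re_mul_sq_nonpos fun u => nonpos_of_forall_quadratic_nonpos (hα1 u)
  have hα3 : 2 * (α * conj A) = 0 :=
    eq_zero_of_forall_re_mul_add_nonpos (c := α.re - 1 / 2) fun u => by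
      have h1 := hα1 u 1
      rw [hα2] at h1
      rw [mul_assoc]
      simpa using h1
  have hα : α = 0 := by linear_combination conj A / 2 * hα3 - hα2
  -- With `α = 0`, the point `w = conj D + conj A * z` maximizes the left side of `hmain`; the
  -- quadratic terms in `z` cancel there.
  have hlin : ∀ z : ℂ, ((D * conj A + conj B - D - A * conj B) * z).re +
      (‖D‖ ^ 2 / 2 - ‖B‖ ^ 2 / 2) ≤ 0 := fun z => by
    have h1 := hmain z (conj D + conj A * z)
    rw [hpq, hpq, hφ1, hφ1, hα] at h1
    simp only [← Complex.normSq_eq_norm_sq] at h1 ⊢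
    simp only [Complex.normSq_apply, Complex.add_re, Complex.add_im, Complex.mul_re,
      Complex.sub_re, Complex.sub_im, Complex.zero_re, Complex.zero_im,
      Complex.mul_im, pow_two, Complex.conj_re, Complex.conj_im] at h1 ⊢
    linarith
  refine ⟨A, B, Complex.exp γ, D, hφ1, fun z => ?_, ?_, ?_⟩
  · rw [hψp, hpq, hα, ← Complex.exp_add]
    ring_nf
  · linear_combination -(eq_zero_of_forall_re_mul_add_nonpos hlin)
  · have h1 := hlin 0
    rw [mul_zero, Complex.zero_re] at h1
    exact le_of_sq_le_sq (by linarith) (norm_nonneg _)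

/-! ## Sufficiency -/

/-- Kernels go to multiples of kernels, which yields both the density of the domain and the formula
for the adjoint. -/
theorem maxWeightedComp_affine_kernel (A B C D w z : ℂ) :
    C * Complex.exp (D * z) * FockSpace.kernel w (A * z + B) =
      C * Complex.exp (B * conj w) * FockSpace.kernel (conj D + conj A * w) z := by
  simp only [FockSpace.kernel_apply, mul_assoc, ← Complex.exp_add]
  congr 2
  simp only [map_add, map_mul, Complex.conj_conj]
  ring

theorem kernel_mem_domain_affine (A B C D w : ℂ) :
    FockSpace.kernel w ∈
      (maxWeightedComp (fun z => C * Complex.exp (D * z)) (fun z => A * z + B)).domain := by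
  change (fun z => _) ∈ fockSubmodule
  simp only [maxWeightedComp_affine_kernel]
  exact fockSubmodule.smul_mem (C * Complex.exp (B * conj w)) (FockSpace.kernel _).mem

theorem dense_domain_affine (A B C D : ℂ) :
    Dense ((maxWeightedComp (fun z => C * Complex.exp (D * z)) (fun z => A * z + B)).domain :
      Set FockSpace) :=
  FockSpace.dense_of_kernel_mem (kernel_mem_domain_affine A B C D)

/-- Pairing `T† g` with `K_w` moves the operator onto the kernel, and the reproducing property
evaluates `g`. Only the action of `T†` is needed, not a description of its domain. -/
theorem adjoint_affine_apply (A B C D : ℂ)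
    (g : (maxWeightedComp (fun z => C * Complex.exp (D * z)) (fun z => A * z + B))†.domain)
    (w : ℂ) :
    (maxWeightedComp (fun z => C * Complex.exp (D * z)) (fun z => A * z + B))† g w =
      conj C * Complex.exp (conj B * w) * (g : FockSpace) (conj A * w + conj D) := by
  have h1 := LinearPMap.adjoint_isFormalAdjoint (dense_domain_affine A B C D) g
    ⟨_, kernel_mem_domain_affine A B C D w⟩
  have h2 : maxWeightedComp (fun z => C * Complex.exp (D * z)) (fun z => A * z + B)
      ⟨_, kernel_mem_domain_affine A B C D w⟩ =
      (C * Complex.exp (B * conj w)) • FockSpace.kernel (conj D + conj A * w) :=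
    FockSpace.ext fun z => maxWeightedComp_affine_kernel A B C D w z
  rw [h2] at h1
  have h3 := congrArg conj h1
  rw [inner_conj_symm, inner_conj_symm, FockSpace.inner_kernel, inner_smul_left,
    FockSpace.inner_kernel, map_mul, ← Complex.exp_conj, map_mul, Complex.conj_conj,
    add_comm (conj D)] at h3
  exact h3

/-- After multiplication by `‖A‖ ^ 2`, the right side minus the left equals `‖B‖ ^ 2 - ‖D‖ ^ 2` plus
a term that `hrel` annihilates. -/
theorem re_mul_sub_norm_sq_le {A B D z z' : ℂ} (hA : A ≠ 0)
    (hrel : D + A * conj B = D * conj A + conj B) (hDB : ‖D‖ ≤ ‖B‖)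
    (hz : conj A * z' + conj D = A * z + B) :
    2 * (D * z).re - ‖z‖ ^ 2 ≤ 2 * (conj B * z').re - ‖z'‖ ^ 2 := by
  have hA' : 0 < Complex.normSq A := Complex.normSq_pos.2 hA
  have hDB' : Complex.normSq D ≤ Complex.normSq B := by
    simp only [Complex.normSq_eq_norm_sq]
    gcongr
  have e0 : conj A * z' = A * z + B - conj D := by linear_combination hz
  have e1 : Complex.normSq A * Complex.normSq z' = Complex.normSq (A * z + B - conj D) := by
    rw [← e0, Complex.normSq_mul, Complex.normSq_conj]
  have e2 : Complex.normSq A * (conj B * z').re = (A * conj B * (A * z + B - conj D)).re := by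
    rw [← e0, ← Complex.re_ofReal_mul, ← Complex.mul_conj]
    ring_nf
  simp only [← Complex.normSq_eq_norm_sq]
  refine le_of_mul_le_mul_left ?_ hA'
  have e3 : Complex.normSq A * (2 * (conj B * z').re - Complex.normSq z') =
      2 * (A * conj B * (A * z + B - conj D)).re - Complex.normSq (A * z + B - conj D) := by
    rw [← e1, ← e2]
    ring
  rw [e3, ← sub_nonneg]
  have h0 : 2 * ((D + A * conj B - (D * conj A + conj B)) * (A * z + B)).re = 0 := by
    rw [sub_eq_zero.2 hrel]
    simp
  have e4 : 2 * (A * conj B * (A * z + B - conj D)).re - Complex.normSq (A * z + B - conj D) -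
      Complex.normSq A * (2 * (D * z).re - Complex.normSq z) =
      Complex.normSq B - Complex.normSq D +
        2 * ((D + A * conj B - (D * conj A + conj B)) * (A * z + B)).re := by
    simp only [Complex.normSq_apply, Complex.add_re, Complex.add_im, Complex.mul_re,
      Complex.sub_re, Complex.sub_im, Complex.mul_im, Complex.conj_re, Complex.conj_im]
    ring
  rw [e4, h0]
  linarith

/-- If a continuous Gaussian integrand is dominated by another one after a rigid motion, then
integrability and the integral bound are inherited. -/
theorem GaussSqIntegrable.of_rigid_motion_le {F G : ℂ → ℂ} (hF : Continuous F)
    (hG : GaussSqIntegrable G) (c : Circle) (d : ℂ)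
    (hle : ∀ z, ‖F z‖ ^ 2 * Real.exp (-‖z‖ ^ 2) ≤
      ‖G (c * z + d)‖ ^ 2 * Real.exp (-‖(c : ℂ) * z + d‖ ^ 2)) :
    GaussSqIntegrable F ∧ ∫ z : ℂ, ‖F z‖ ^ 2 * Real.exp (-‖z‖ ^ 2) ≤
      ∫ z : ℂ, ‖G z‖ ^ 2 * Real.exp (-‖z‖ ^ 2) := by
  have hmp : MeasurePreserving (fun z : ℂ => (c : ℂ) * z + d) volume volume :=
    (measurePreserving_add_right volume d).comp (rotation c).measurePreserving
  have hemb : MeasurableEmbedding (fun z : ℂ => (c : ℂ) * z + d) :=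
    (MeasurableEquiv.addRight d).measurableEmbedding.comp
      (rotation c).toHomeomorph.measurableEmbedding
  have hint := (hmp.integrable_comp_emb hemb).2 hG
  have hFi : GaussSqIntegrable F := by
    refine hint.mono' (Continuous.aestronglyMeasurable (by fun_prop))
      (Eventually.of_forall fun z => ?_)
    rw [Real.norm_of_nonneg (by positivity)]
    exact hle z
  refine ⟨hFi, ?_⟩
  rw [← hmp.integral_comp hemb (fun z : ℂ => ‖G z‖ ^ 2 * Real.exp (-‖z‖ ^ 2))]
  exact integral_mono hFi hint hle

theorem affine_gauss_comparison {A B C D : ℂ} (hrel : D + A * conj B = D * conj A + conj B)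
    (hDB : ‖D‖ ≤ ‖B‖) {g : ℂ → ℂ} (hg : Differentiable ℂ g)
    (hG : GaussSqIntegrable fun z => conj C * Complex.exp (conj B * z) * g (conj A * z + conj D)) :
    GaussSqIntegrable (fun z => C * Complex.exp (D * z) * g (A * z + B)) ∧
      ∫ z : ℂ, ‖C * Complex.exp (D * z) * g (A * z + B)‖ ^ 2 * Real.exp (-‖z‖ ^ 2) ≤
      ∫ z : ℂ, ‖conj C * Complex.exp (conj B * z) * g (conj A * z + conj D)‖ ^ 2 *
        Real.exp (-‖z‖ ^ 2) := by
  have hgc := hg.continuous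
  by_cases hA : A = 0
  · have hD : D = conj B := by simpa [hA] using hrel
    -- For `A = 0` both arguments of `g` are the constant `B`, and the two integrands coincide.
    refine GaussSqIntegrable.of_rigid_motion_le (by fun_prop) hG 1 0 fun z => le_of_eq ?_
    simp [hA, hD]
  have hA' : conj A ≠ 0 := (map_ne_zero _).2 hA
  have hnorm : ‖A / conj A‖ = 1 := by
    rw [norm_div, RCLike.norm_conj, div_self (norm_ne_zero_iff.2 hA)]
  -- The motion is the solution `z'` of `conj A * z' + conj D = A * z + B`; its slope `A / conj A`
  -- is unimodular.
  refine GaussSqIntegrable.of_rigid_motion_le (by fun_prop) hG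
    ⟨A / conj A, mem_sphere_zero_iff_norm.2 hnorm⟩ ((B - conj D) / conj A) fun z => ?_
  set z' := A / conj A * z + (B - conj D) / conj A with hz'
  have hz : conj A * z' + conj D = A * z + B := by
    rw [hz']
    field_simp
    ring
  change _ ≤ ‖conj C * Complex.exp (conj B * z') * g (conj A * z' + conj D)‖ ^ 2 *
    Real.exp (-‖z'‖ ^ 2)
  rw [hz]
  simp only [norm_mul, mul_pow, RCLike.norm_conj, Complex.norm_exp, ← Real.exp_nat_mul]
  have h := Real.exp_le_exp.2 (re_mul_sub_norm_sq_le hA hrel hDB hz)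
  rw [sub_eq_add_neg, sub_eq_add_neg, Real.exp_add, Real.exp_add] at h
  have hnn : 0 ≤ ‖C‖ ^ 2 * ‖g (A * z + B)‖ ^ 2 := by positivity
  have h2 := mul_le_mul_of_nonneg_left h hnn
  push_cast
  linarith

theorem isCohyponormal_affine {A B C D : ℂ} (hrel : D + A * conj B = D * conj A + conj B)
    (hDB : ‖D‖ ≤ ‖B‖) :
    IsCohyponormal (maxWeightedComp (fun z => C * Complex.exp (D * z)) (fun z => A * z + B)) := by
  have hcmp : ∀ g : (maxWeightedComp (fun z => C * Complex.exp (D * z))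
      (fun z => A * z + B))†.domain, _ := fun g =>
    affine_gauss_comparison (C := C) hrel hDB (g : FockSpace).differentiable
      (by
        have h := ((maxWeightedComp (fun z => C * Complex.exp (D * z))
          (fun z => A * z + B))† g).gaussSqIntegrable
        rwa [funext (adjoint_affine_apply A B C D g)] at h)
  refine ⟨isClosed_maxWeightedComp, dense_domain_affine A B C D, fun g hg => ?_, fun g => ?_⟩
  · have hgd := g.differentiable
    exact ⟨by fun_prop, (hcmp ⟨g, hg⟩).1⟩
  · have hpi := Real.pi_pos
    refine le_of_sq_le_sq ?_ (norm_nonneg _)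
    rw [FockSpace.norm_sq_eq, FockSpace.norm_sq_eq]
    refine mul_le_mul_of_nonneg_left ?_ (by positivity)
    simp only [adjoint_affine_apply, maxWeightedComp_apply]
    exact (hcmp g).2

/-! ### The equivalence. -/

theorem theorem6p2 (ψ φ : ℂ → ℂ) (hψ : Differentiable ℂ ψ) (hφ : Differentiable ℂ φ)
    (hψ0 : ψ ≠ 0) :
    IsCohyponormal (maxWeightedComp ψ φ) ↔
      (∃ A B C D : ℂ, A ≠ 1 ∧ (∀ z, φ z = A * z + B) ∧ (∀ z, ψ z = C * Complex.exp (D * z)) ∧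
        D = conj B * (1 - A) * (1 - conj A)⁻¹) ∨
      (∃ B C D : ℂ, (∀ z, φ z = z + B) ∧ (∀ z, ψ z = C * Complex.exp (D * z)) ∧
        ‖D‖ ≤ ‖B‖) := by
  have hconj : ∀ A : ℂ, A ≠ 1 → 1 - conj A ≠ 0 := fun A hA h0 => hA <| by
    have h1 := congrArg conj (sub_eq_zero.1 h0)
    rw [map_one, Complex.conj_conj] at h1
    exact h1.symm
  constructor
  · intro h
    obtain ⟨A, B, C, D, hφA, hψC, hrel, hDB⟩ := h.exists_coeff hψ hφ hψ0
    by_cases hA : A = 1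
    · exact Or.inr ⟨B, C, D, fun z => by rw [hφA, hA, one_mul], hψC, hDB⟩
    · refine Or.inl ⟨A, B, C, D, hA, hφA, hψC, ?_⟩
      rw [eq_mul_inv_iff_mul_eq₀ (hconj A hA)]
      linear_combination hrel
  · rintro (⟨A, B, C, D, hA, hφA, hψC, hD⟩ | ⟨B, C, D, hφB, hψC, hDB⟩)
    · rw [funext hφA, funext hψC]
      refine isCohyponormal_affine ?_ (le_of_eq ?_)
      · rw [eq_mul_inv_iff_mul_eq₀ (hconj A hA)] at hD
        linear_combination hD
      -- The quotient `(1 - A) / (1 - conj A)` is unimodular, so `‖D‖ = ‖B‖` holds automatically.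
      · have h1 : ‖1 - conj A‖ = ‖1 - A‖ := by
          rw [← RCLike.norm_conj (1 - A), map_sub, map_one]
        rw [hD, norm_mul, norm_mul, norm_inv, h1, RCLike.norm_conj, mul_assoc, mul_inv_cancel₀,
          mul_one]
        rw [← h1]
        exact norm_ne_zero_iff.2 (hconj A hA)
    · rw [show φ = fun z => 1 * z + B from funext fun z => by rw [hφB, one_mul], funext hψC]
      exact isCohyponormal_affine (by simp) hDB
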